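/- Let $n\ge 0$ be an integer, let $T,\epsilon>0$ and let $F:\mathbb R^n\times\mathbb R_{\ge 0}\to 2^{\mathbb R^n}$ be a set-valued map. Consider the differential inclusion $\dot x\in F(x,t)$. Definitions. An interval is a connected set $I\subseteq\mathbb R$ of nonzero Lebesgue measure; suprema of intervals are taken in $\mathbb R\cup\{\infty\}$. Let $S$ be a subset of an interval $I$ and let $g:I\to\mathbb R^n$. The function $g$ is $AC_*$ on $S$ if for each $\eta>0$ there is $\delta>0$ such that $\sum_{i=1}^m\sup_{a,b\in[a_i,b_i]}\|g(b)-g(a)\|<\eta$ for every finite collection of non-overlapping intervals $[a_i,b_i]$ with $a_i,b_i\in S$ and $\sum_{i=1}^m|b_i-a_i|<\delta$. It is $ACG_*$ on $S$ if $g|_S$ is continuous and $S$ is a union of countably many sets on each of which $g$ is $AC_*$. A generalized solution of the inclusion is a function $x:I\to\mathbb R^n$ on an interval $I\subseteq\mathbb R_{\ge 0}$ that is $ACG_*$ on $I$ and satisfies $\dot x(t)\in F(x(t),t)$ for almost every $t\in I$. A generalized solution $x:I\to\mathbb R^n$ is maximal if there is no generalized solution $\bar x:\bar I\to\mathbb R^n$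 with $\bar I\cap I\neq\emptyset$, $\sup\bar I>\sup I$, and $\bar x(t)=x(t)$ for all $t\in I\cap\bar I$. Theorem. Suppose that $F$ is upper semicontinuous on every compact subset of $\mathcal E=\mathbb R^n\times[T,T+\epsilon)$ (that is, for every compact $K\subseteq\mathcal E$, every $p\in K$ and every open $V\supseteq F(p)$, one has $F(q)\subseteq V$ for all $q\in K$ sufficiently close to $p$), and that $F(x,t)$ is nonempty, compact and convex for all $(x,t)\in\mathcal E$. Let $x:I\to\mathbb R^n$ be a maximal generalized solution of $\dot x\in F(x,t)$. If $\sup I\ge T$ and $\lim_{t\to T,\ t\in I\setminus\{T\}}x(t)$ exists, then there exists $\delta>0$ such that $\sup I\ge T+\delta$. -/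

import Mathlib

namespace GenFilippov

/-- The state space `ℝⁿ` with its Euclidean norm. -/
abbrev State (n : ℕ) : Type := EuclideanSpace ℝ (Fin n)

/-- An interval: a connected subset of `ℝ` of nonzero Lebesgue measure. -/
def IsInterval (I : Set ℝ) : Prop :=
  IsConnected I ∧ MeasureTheory.volume I ≠ 0

/-- `g` is absolutely continuous in the restricted sense (AC⁎) on `S`.  The oscillation
`sup {‖g q - g p‖ : p, q ∈ [a i, b i]}` is the extended-real-valued diameter of the image
of `[a i, b i]`, so that an infinite oscillation counts as infinite. -/
def ACStarOn {n : ℕ} (g : ℝ → State n) (S : Set ℝ) : Prop :=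
  ∀ ε : ℝ, 0 < ε → ∃ δ : ℝ, 0 < δ ∧
    ∀ (m : ℕ) (a b : Fin m → ℝ),
      (∀ i, a i < b i ∧ a i ∈ S ∧ b i ∈ S) →
      (Pairwise fun i j => Disjoint (Set.Ioo (a i) (b i)) (Set.Ioo (a j) (b j))) →
      ∑ i, |b i - a i| < δ →
      ∑ i, Metric.ediam (g '' Set.Icc (a i) (b i)) < ENNReal.ofReal ε

/-- `g` is generalized absolutely continuous in the restricted sense (ACG⁎) on `S`. -/
def ACGStarOn {n : ℕ} (g : ℝ → State n) (S : Set ℝ) : Prop :=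
  ContinuousOn g S ∧ ∃ E : ℕ → Set ℝ, S = ⋃ k, E k ∧ ∀ k, ACStarOn g (E k)

/-- The function `x|_I : I → ℝⁿ` is a generalized solution of `ẋ ∈ F(x, t)`.
Only the values of `x` on `I ⊆ [0, ∞)` and the values of `F` at times `t ≥ 0` matter. -/
structure IsGeneralizedSolution {n : ℕ} (F : State n × ℝ → Set (State n))
    (x : ℝ → State n) (I : Set ℝ) : Prop where
  interval : IsInterval I
  nonneg : I ⊆ Set.Ici 0
  acgStar : ACGStarOn x I
  inclusion : ∀ᵐ t ∂MeasureTheory.volume, t ∈ I →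
    ∃ v ∈ F (x t, t), HasDerivWithinAt x v I t

/-- The supremum of a set of reals, taken in `[-∞, ∞]`. -/
noncomputable def supTime (I : Set ℝ) : EReal := sSup ((fun t : ℝ => (t : EReal)) '' I)

/-- `x|_I` is a maximal generalized solution: no generalized solution that agrees with it on
a nonempty common domain reaches further to the right. -/
def IsMaximalGeneralizedSolution {n : ℕ} (F : State n × ℝ → Set (State n))
    (x : ℝ → State n) (I : Set ℝ) : Prop :=
  IsGeneralizedSolution F x I ∧
    ¬ ∃ (y : ℝ → State n) (J : Set ℝ), IsGeneralizedSolution F y J ∧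
      (J ∩ I).Nonempty ∧ supTime I < supTime J ∧ ∀ t ∈ I ∩ J, x t = y t

end GenFilippov

open Filter Topology Set

namespace GenFilippov

/-! ### Limits of Euler schemes for discontinuous right-hand sides. -/

section Euler

variable {E : Type*} [NormedAddCommGroup E] [NormedSpace ℝ E]

/-! If no `δ` works, `I` lies in `(-∞, T]` and contains some `[a, T)`. Restarting at `T` from the
limit of `x` then extends the solution past `sup I`, against maximality. Forward existence
(`exists_lipschitz_solution`) uses Euler schemes for an arbitrary bounded selection of `F`.
Convexity keeps their averaged velocities near `F (z t, t)` by upper semicontinuity, and closedness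
puts the derivative of the limit inside it. Gluing (`IsGeneralizedSolution.glue`) preserves ACG⁎
because the Lipschitz piece adds just one AC⁎ set to the countable cover. -/

/-- The nodes of the explicit Euler scheme with step `h` for `ẋ = f (x, t)`, `x T = l`. -/
noncomputable def eulerNode (f : E × ℝ → E) (T : ℝ) (l : E) (h : ℝ) : ℕ → E
  | 0 => l
  | k + 1 => eulerNode f T l h k + h • f (eulerNode f T l h k, T + k * h)

lemma eulerNode_sub (f : E × ℝ → E) (T : ℝ) (l : E) (h : ℝ) {j i : ℕ} (hji : j ≤ i) :
    eulerNode f T l h i - eulerNode f T l h j =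
      h • ∑ k ∈ Finset.Ico j i, f (eulerNode f T l h k, T + k * h) := by
  induction i, hji using Nat.le_induction with
  | base => simp
  | succ i hji ih =>
    rw [Finset.sum_Ico_succ_top hji, smul_add, ← ih, eulerNode]
    abel

lemma norm_eulerNode_sub_le {f : E × ℝ → E} {M : ℝ} (hf : ∀ q, ‖f q‖ ≤ M) (T : ℝ) (l : E)
    {h : ℝ} (hh : 0 ≤ h) {j i : ℕ} (hji : j ≤ i) :
    ‖eulerNode f T l h i - eulerNode f T l h j‖ ≤ M * (h * ((i : ℝ) - j)) := by
  rw [eulerNode_sub f T l h hji, norm_smul, Real.norm_of_nonneg hh]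
  have h1 : ‖∑ k ∈ Finset.Ico j i, f (eulerNode f T l h k, T + k * h)‖ ≤ ((i : ℝ) - j) * M := by
    refine (norm_sum_le_of_le _ fun k _ => hf _).trans ?_
    simp [Nat.cast_sub hji]
  calc _ ≤ h * (((i : ℝ) - j) * M) := by gcongr
    _ = _ := by ring

/-- Rounding both times down to the grid costs at most one extra step `h`. -/
lemma mul_floor_sub_floor_le {a b h : ℝ} (hh : 0 < h) (hab : a ≤ b) :
    h * ((⌊b / h⌋₊ : ℝ) - ⌊a / h⌋₊) ≤ b - a + h := by
  have ha : a / h < ⌊a / h⌋₊ + 1 := Nat.lt_floor_add_one _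
  have hab' : a / h ≤ b / h := by gcongr
  have key : (⌊b / h⌋₊ : ℝ) - ⌊a / h⌋₊ ≤ b / h - a / h + 1 := by
    rcases le_or_gt 0 (b / h) with hb | hb
    · linarith [Nat.floor_le hb]
    · simp only [Nat.floor_of_nonpos hb.le, Nat.floor_of_nonpos (hab'.trans hb.le)]
      simp
      linarith
  calc _ ≤ h * (b / h - a / h + 1) := by gcongr
    _ = b - a + h := by field_simp

lemma tendsto_mul_floor_div {a : ℝ} (ha : 0 ≤ a) :
    Tendsto (fun h : ℝ => h * (⌊a / h⌋₊ : ℝ)) (𝓝[>] 0) (𝓝 a) := by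
  have := (tendsto_nat_floor_mul_div_atTop (R := ℝ) ha).comp tendsto_inv_nhdsGT_zero
  refine this.congr fun h => ?_
  simp [div_eq_mul_inv, mul_comm]

/-- The average of the increments of an Euler scheme lies in every convex set that contains all
the velocities used. -/
lemma average_eulerNode_mem {f : E × ℝ → E} {T : ℝ} {l : E} {h : ℝ} (hh : 0 < h) {j i : ℕ}
    (hji : j < i) {C : Set E} (hC : Convex ℝ C)
    (hmem : ∀ k, j ≤ k → k < i → f (eulerNode f T l h k, T + k * h) ∈ C) :
    (h * ((i : ℝ) - j))⁻¹ • (eulerNode f T l h i - eulerNode f T l h j) ∈ C := by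
  have hpos : (0 : ℝ) < (i : ℝ) - j := sub_pos.2 (by exact_mod_cast hji)
  rw [eulerNode_sub f T l h hji.le, smul_smul, mul_inv, mul_right_comm, inv_mul_cancel₀ hh.ne',
    one_mul, Finset.smul_sum]
  refine hC.sum_mem (fun _ _ => by positivity) ?_ fun k hk => ?_
  · simp [Nat.cast_sub hji.le, hpos.ne']
  · exact hmem k (Finset.mem_Ico.1 hk).1 (Finset.mem_Ico.1 hk).2

/-- A limit of Euler schemes for a bounded, possibly discontinuous right-hand side: it is Lipschitz,
and its right difference quotients at `t` lie in every closed convex set that contains the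
values of `f` near `(x t, t)`. -/
theorem exists_limit_of_euler [ProperSpace E] {f : E × ℝ → E} {M : NNReal} (hf : ∀ q, ‖f q‖ ≤ M)
    (T : ℝ) (l : E) :
    ∃ x : ℝ → E, LipschitzWith M x ∧ x T = l ∧
      ∀ t, T ≤ t → ∀ C : Set E, IsClosed C → Convex ℝ C → (∀ᶠ q in 𝓝 (x t, t), f q ∈ C) →
        ∀ᶠ s in 𝓝[>] t, slope x t s ∈ C := by
  -- Along an ultrafilter of step sizes every bounded family converges, so no subsequence has to be
  -- extracted.
  set U : Ultrafilter ℝ := Ultrafilter.of (𝓝[>] (0 : ℝ))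
  have hU : (U : Filter ℝ) ≤ 𝓝[>] 0 := Ultrafilter.of_le _
  set X : ℝ → ℝ → E := fun h t => eulerNode f T l h ⌊(t - T) / h⌋₊ with hX
  have hU0 : ∀ᶠ h in (U : Filter ℝ), 0 < h := hU self_mem_nhdsWithin
  have hUlim : Tendsto (fun h : ℝ => h) U (𝓝 0) := hU.trans nhdsWithin_le_nhds
  have hXle : ∀ h, 0 < h → ∀ t s, t ≤ s → ‖X h s - X h t‖ ≤ M * (s - t + h) := by
    intro h hh t s hts
    refine (norm_eulerNode_sub_le hf T l hh.le (Nat.floor_le_floor (by gcongr))).trans ?_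
    have := mul_floor_sub_floor_le hh (sub_le_sub_right hts T)
    gcongr
    linarith
  have hXT : ∀ h, X h T = l := fun h => by simp [hX, eulerNode]
  have hlim : ∀ t, ∃ y, Tendsto (fun h => X h t) U (𝓝 y) := by
    intro t
    have hb : ∀ᶠ h in (U : Filter ℝ), X h t ∈ Metric.closedBall l (M * (|t - T| + 1)) := by
      filter_upwards [hU0, hUlim.eventually_le_const one_pos] with h hh hh1
      rw [mem_closedBall_iff_norm, ← hXT h]
      rcases le_total T t with hTt | hTt
      · refine (hXle h hh T t hTt).trans ?_
        gcongr
        exact le_abs_self _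
      · rw [norm_sub_rev]
        refine (hXle h hh t T hTt).trans ?_
        gcongr
        rw [abs_sub_comm]
        exact le_abs_self _
    obtain ⟨y, -, hy⟩ := (isCompact_closedBall l (M * (|t - T| + 1))).ultrafilter_le_nhds
      (U.map fun h => X h t) (le_principal_iff.2 hb)
    exact ⟨y, hy⟩
  choose x hx using hlim
  refine ⟨x, ?_, ?_, ?_⟩
  · have hle : ∀ t s, t ≤ s → ‖x s - x t‖ ≤ M * (s - t) := by
      intro t s hts
      have h1 : Tendsto (fun h => M * (s - t + h)) U (𝓝 (M * (s - t + 0))) :=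
        (tendsto_const_nhds.add hUlim).const_mul _
      rw [add_zero] at h1
      refine le_of_tendsto_of_tendsto ((hx s).sub (hx t)).norm h1 ?_
      filter_upwards [hU0] with h hh using hXle h hh t s hts
    refine LipschitzWith.of_dist_le_mul fun t s => ?_
    rw [dist_eq_norm, Real.dist_eq]
    rcases le_total t s with hts | hts
    · rw [norm_sub_rev, abs_sub_comm, abs_of_nonneg (sub_nonneg.2 hts)]
      exact hle t s hts
    · rw [abs_of_nonneg (sub_nonneg.2 hts)]
      exact hle s t hts
  · exact tendsto_nhds_unique (hx T) (by simp [hXT])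
  · intro t ht C hCc hC hfC
    obtain ⟨r, hr, hrC⟩ := Metric.eventually_nhds_iff.1 hfC
    -- One `ρ` bounds `s - t`, the other the step `h`; the nodes then drift less than `r / 2`,
    -- leaving `r / 2` for the error of `X h t`.
    obtain ⟨ρ, hρ, hρr, hMρ⟩ : ∃ ρ : ℝ, 0 < ρ ∧ ρ < r ∧ M * (ρ + ρ) < r / 2 := by
      refine ⟨r / (4 * (M + 2)), by positivity, ?_, ?_⟩
      · rw [div_lt_iff₀ (by positivity)]
        nlinarith [M.coe_nonneg]
      · have : (M : ℝ) * (r / (4 * (M + 2)) + r / (4 * (M + 2))) = r / 2 * (M / (M + 2)) := by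
          field_simp
          ring
        rw [this]
        have h1 : (M : ℝ) / (M + 2) < 1 := by
          rw [div_lt_one (by positivity)]
          linarith
        nlinarith
    filter_upwards [Ioo_mem_nhdsGT (show t < t + ρ by linarith)] with s hs
    have hden : Tendsto (fun h : ℝ => h * ((⌊(s - T) / h⌋₊ : ℝ) - ⌊(t - T) / h⌋₊)) U
        (𝓝 (s - t)) := by
      have := ((tendsto_mul_floor_div (a := s - T) (by linarith [hs.1])).sub
        (tendsto_mul_floor_div (a := t - T) (by linarith))).mono_left hU
      refine (this.congr fun h => by ring).trans_eq ?_
      ring_nf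
    have hst : 0 < s - t := sub_pos.2 hs.1
    have hquot := (hden.inv₀ hst.ne').smul ((hx s).sub (hx t))
    rw [slope_def_module]
    refine hCc.mem_of_tendsto hquot ?_
    filter_upwards [hU0, hUlim.eventually_lt_const hρ, hden.eventually_const_lt hst,
      (hx t).eventually (Metric.ball_mem_nhds (x t) (half_pos hr))] with h hh hhρ hpos hball
    have hji : ⌊(t - T) / h⌋₊ < ⌊(s - T) / h⌋₊ := by
      have := (mul_pos_iff_of_pos_left hh).1 hpos
      exact_mod_cast sub_pos.1 this
    refine average_eulerNode_mem hh hji hC fun k hjk hki => hrC ?_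
    -- The first node may precede `t`, hence the two-sided neighbourhood in the hypothesis on `C`.
    have hkt : t - h < T + k * h := by
      have h1 := Nat.lt_floor_add_one ((t - T) / h)
      rw [div_lt_iff₀ hh] at h1
      have h2 : (⌊(t - T) / h⌋₊ : ℝ) * h ≤ k * h := by gcongr
      linarith
    have hks : T + k * h ≤ s := by
      have h1 : (⌊(s - T) / h⌋₊ : ℝ) ≤ (s - T) / h :=
        Nat.floor_le (div_nonneg (by linarith [hs.1]) hh.le)
      rw [le_div_iff₀ hh] at h1
      have h2 : (k : ℝ) * h ≤ ⌊(s - T) / h⌋₊ * h := by gcongr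
      linarith
    rw [Prod.dist_eq, max_lt_iff]
    constructor
    · have h1 := norm_eulerNode_sub_le hf T l hh.le hjk
      have h2 : h * ((k : ℝ) - ⌊(t - T) / h⌋₊) ≤ ρ + ρ := by
        have h3 := mul_floor_sub_floor_le hh (show t - T ≤ s - T by linarith [hs.1])
        have h4 : h * ((k : ℝ) - ⌊(t - T) / h⌋₊) ≤
            h * ((⌊(s - T) / h⌋₊ : ℝ) - ⌊(t - T) / h⌋₊) := by gcongr
        linarith [hs.2]
      have h5 : ‖eulerNode f T l h k - X h t‖ ≤ M * (ρ + ρ) := h1.trans (by gcongr)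
      calc dist (eulerNode f T l h k) (x t)
          ≤ dist (eulerNode f T l h k) (X h t) + dist (X h t) (x t) := dist_triangle _ _ _
        _ < r / 2 + r / 2 := by
          rw [dist_eq_norm (eulerNode f T l h k)]
          exact add_lt_add (h5.trans_lt hMρ) hball
        _ = r := add_halves r
    · rw [Real.dist_eq, abs_lt]
      constructor <;> linarith [hs.2]

end Euler

/-! ### Local existence for the inclusion. -/

/-- An upper hemicontinuous correspondence with bounded values is bounded on compact sets. -/
lemma exists_norm_le_of_upperHemicontinuousOn {X E : Type*} [TopologicalSpace X]
    [NormedAddCommGroup E] {F : X → Set E} {K : Set X} (hK : IsCompact K)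
    (hF : UpperHemicontinuousOn F K) (hb : ∀ p ∈ K, Bornology.IsBounded (F p)) :
    ∃ M : NNReal, ∀ q ∈ K, ∀ v ∈ F q, ‖v‖ ≤ M := by
  refine hK.induction_on (p := fun s => ∃ M : NNReal, ∀ q ∈ s, ∀ v ∈ F q, ‖v‖ ≤ M)
    ⟨0, by simp⟩ (fun s t hst ⟨M, hM⟩ => ⟨M, fun q hq => hM q (hst hq)⟩) ?_ ?_
  · rintro s t ⟨M, hM⟩ ⟨N, hN⟩
    refine ⟨max M N, fun q hq v hv => ?_⟩
    rcases hq with hq | hq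
    · exact (hM q hq v hv).trans (by simp)
    · exact (hN q hq v hv).trans (by simp)
  · intro p hp
    obtain ⟨r, hr⟩ := (hb p hp).subset_ball 0
    refine ⟨_, hF.forall_isOpen p hp _ Metric.isOpen_ball hr, r.toNNReal, fun q hq v hv => ?_⟩
    exact (mem_ball_zero_iff.1 (hq hv)).le.trans (Real.le_coe_toNNReal r)

/-- Local existence of Lipschitz solutions of a differential inclusion whose right-hand side is upper
hemicontinuous with nonempty compact convex values. -/
theorem exists_lipschitz_solution {E : Type*} [NormedAddCommGroup E] [NormedSpace ℝ E]
    [FiniteDimensional ℝ E] {F : E × ℝ → Set E} {T b R : ℝ} (hTb : T < b) (hR : 0 < R) {l : E}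
    (husc : UpperHemicontinuousOn F (Metric.closedBall l R ×ˢ Icc T b))
    (hval : ∀ p ∈ Metric.closedBall l R ×ˢ Icc T b,
      (F p).Nonempty ∧ IsCompact (F p) ∧ Convex ℝ (F p)) :
    ∃ δ : ℝ, 0 < δ ∧ ∃ (M : NNReal) (z : ℝ → E), LipschitzWith M z ∧ z T = l ∧
      ∀ᵐ t, t ∈ Ioo T (T + δ) → ∃ v ∈ F (z t, t), HasDerivAt z v t := by
  classical
  have : ProperSpace E := FiniteDimensional.proper ℝ E
  set K : Set (E × ℝ) := Metric.closedBall l R ×ˢ Icc T b with hKdef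
  have hK : IsCompact K := (isCompact_closedBall l R).prod isCompact_Icc
  obtain ⟨M, hM⟩ := exists_norm_le_of_upperHemicontinuousOn hK husc
    fun p hp => (hval p hp).2.1.isBounded
  obtain ⟨f, hfF, hf⟩ : ∃ f : E × ℝ → E, (∀ q ∈ K, f q ∈ F q) ∧ ∀ q, ‖f q‖ ≤ M := by
    refine ⟨fun q => if hq : q ∈ K then (hval q hq).1.some else 0, fun q hq => ?_, fun q => ?_⟩
    · simpa [hq] using (hval q hq).1.some_mem
    · by_cases hq : q ∈ K
      · simpa [hq] using hM q hq _ (hval q hq).1.some_mem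
      · simp [hq]
  obtain ⟨z, hz, hzT, hslope⟩ := exists_limit_of_euler hf T l
  -- Up to this time the graph of `z` stays inside the cylinder `K`; the `+ 1` covers `M = 0`.
  refine ⟨min (b - T) (R / (M + 1)), by positivity [sub_pos.2 hTb], M, z, hz, hzT, ?_⟩
  filter_upwards [hz.ae_differentiableAt_real] with t hdiff ht
  have hδ1 : t < b := by linarith [ht.2, min_le_left (b - T) (R / (M + 1))]
  have hδ2 : (t - T) * (M + 1) < R := by
    rw [← lt_div_iff₀ (by positivity)]
    linarith [ht.2, min_le_right (b - T) (R / (M + 1))]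
  have hzl : dist (z t) l < R := by
    have h1 := hz.dist_le_mul t T
    rw [hzT, Real.dist_eq, abs_of_pos (sub_pos.2 ht.1)] at h1
    linarith [ht.1]
  have hKn : K ∈ 𝓝 (z t, t) :=
    prod_mem_nhds (Metric.closedBall_mem_nhds_of_mem hzl) (Icc_mem_nhds ht.1 hδ1)
  have htK : (z t, t) ∈ K := mem_of_mem_nhds hKn
  obtain ⟨-, hcomp, hconv⟩ := hval _ htK
  refine ⟨deriv z t, ?_, hdiff.hasDerivAt⟩
  -- Closed thickenings of `F (z t, t)` are convex and contain all nearby values of `f`.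
  rw [← hcomp.isClosed.closure_eq, Metric.closure_eq_iInter_cthickening]
  refine mem_iInter₂.2 fun η hη => ?_
  have hev : ∀ᶠ q in 𝓝 (z t, t), f q ∈ Metric.cthickening η (F (z t, t)) := by
    have h1 := husc.forall_isOpen _ htK _ Metric.isOpen_thickening
      (Metric.self_subset_thickening hη (F (z t, t)))
    rw [nhdsWithin_eq_nhds.2 hKn] at h1
    filter_upwards [h1, hKn] with q hq hqK
    exact Metric.thickening_subset_cthickening _ _ (hq (hfF q hqK))
  refine Metric.isClosed_cthickening.mem_of_tendsto ?_
    (hslope t ht.1.le _ Metric.isClosed_cthickening (hconv.cthickening η) hev)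
  exact (hasDerivAt_iff_tendsto_slope.1 hdiff.hasDerivAt).mono_left
    (nhdsWithin_mono _ fun s hs => (mem_Ioi.1 hs).ne')

/-! ### AC⁎ functions and gluing. -/

lemma ACStarOn.mono {n : ℕ} {g : ℝ → State n} {S S' : Set ℝ} (h : ACStarOn g S) (hS : S' ⊆ S) :
    ACStarOn g S' := fun ε hε => by
  obtain ⟨δ, hδ, H⟩ := h ε hε
  exact ⟨δ, hδ, fun m a b hab => H m a b fun i => ⟨(hab i).1, hS (hab i).2.1, hS (hab i).2.2⟩⟩

/-- Oscillations see all of `[a i, b i]`, so agreement on `S` alone would not suffice. -/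
lemma ACStarOn.congr {n : ℕ} {g g' : ℝ → State n} {S S' : Set ℝ} (h : ACStarOn g S)
    (hS' : S'.OrdConnected) (hS : S ⊆ S') (hg : EqOn g' g S') : ACStarOn g' S := fun ε hε => by
  obtain ⟨δ, hδ, H⟩ := h ε hε
  refine ⟨δ, hδ, fun m a b hab hd hs => ?_⟩
  have : ∀ i, g' '' Icc (a i) (b i) = g '' Icc (a i) (b i) := fun i =>
    (hg.mono (hS'.out (hS (hab i).2.1) (hS (hab i).2.2))).image_eq
  simpa only [this] using H m a b hab hd hs

lemma acStarOn_of_lipschitzWith {n : ℕ} {g : ℝ → State n} {M : NNReal} (hg : LipschitzWith M g)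
    (S : Set ℝ) : ACStarOn g S := fun ε hε => by
  refine ⟨ε / (M + 1), by positivity, fun m a b hab _ hs => ?_⟩
  calc ∑ i, Metric.ediam (g '' Icc (a i) (b i))
      ≤ ∑ i, (M : ENNReal) * ENNReal.ofReal |b i - a i| := by
        refine Finset.sum_le_sum fun i _ => (hg.ediam_image_le _).trans ?_
        rw [Real.ediam_Icc]
        gcongr
        exact le_abs_self _
    _ = ENNReal.ofReal (M * ∑ i, |b i - a i|) := by
        rw [← Finset.mul_sum, ← ENNReal.ofReal_sum_of_nonneg fun _ _ => abs_nonneg _,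
          ENNReal.ofReal_mul M.coe_nonneg, ENNReal.ofReal_coe_nnreal]
    _ < ENNReal.ofReal ε := by
        rw [ENNReal.ofReal_lt_ofReal_iff hε]
        rw [lt_div_iff₀ (by positivity)] at hs
        have : 0 ≤ ∑ i, |b i - a i| := Finset.sum_nonneg fun _ _ => abs_nonneg _
        rcases this.eq_or_lt with h0 | h0
        · simpa [← h0] using hε
        · linarith

/-- Gluing a generalized solution that has a limit at `T` from the left with a Lipschitz solution
that starts at this limit. -/
lemma IsGeneralizedSolution.glue {n : ℕ} {F : State n × ℝ → Set (State n)} {x z : ℝ → State n}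
    {I : Set ℝ} (hx : IsGeneralizedSolution F x I) {a T c : ℝ} (haT : a < T) (hTc : T < c)
    (hI : Ico a T ⊆ I) {M : NNReal} (hz : LipschitzWith M z)
    (hlim : Tendsto x (𝓝[I \ {T}] T) (𝓝 (z T)))
    (hzF : ∀ᵐ t, t ∈ Ioo T c → ∃ v ∈ F (z t, t), HasDerivAt z v t) :
    IsGeneralizedSolution F (fun t => if t < T then x t else z t) (Icc a c) := by
  have hac : a < c := haT.trans hTc
  have hyx : EqOn (fun t => if t < T then x t else z t) x (Iio T) := fun t ht => if_pos ht
  have hyz : EqOn (fun t => if t < T then x t else z t) z (Ici T) := fun t ht =>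
    if_neg (not_lt.2 ht)
  have hsplit : Icc a c = Ico a T ∪ Icc T c := (Ico_union_Icc_eq_Icc haT.le hTc.le).symm
  have hnhds : ∀ t < T, I ∈ 𝓝[Icc a c] t := fun t ht => by
    filter_upwards [self_mem_nhdsWithin, mem_nhdsWithin_of_mem_nhds (Iio_mem_nhds ht)]
      with s hs hsT using hI ⟨hs.1, hsT⟩
  refine ⟨⟨isConnected_Icc hac.le, ?_⟩, ?_, ⟨?_, ?_⟩, ?_⟩
  · simp [hac]
  · intro t ht
    exact (hx.nonneg (hI ⟨le_rfl, haT⟩) : (0 : ℝ) ≤ a).trans ht.1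
  · intro t ht
    rcases lt_or_ge t T with htT | htT
    · have h1 : ContinuousWithinAt x (Icc a c) t :=
        (hx.acgStar.1 t (hI ⟨ht.1, htT⟩)).mono_of_mem_nhdsWithin (hnhds t htT)
      refine h1.congr_of_eventuallyEq ?_ (hyx htT)
      exact hyx.eventuallyEq_of_mem (mem_nhdsWithin_of_mem_nhds (Iio_mem_nhds htT))
    · have hr : ContinuousWithinAt (fun t => if t < T then x t else z t) (Icc T c) t :=
        hz.continuous.continuousWithinAt.congr (fun s hs => hyz hs.1) (hyz htT)
      rw [hsplit]
      refine ContinuousWithinAt.union ?_ hr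
      rcases htT.eq_or_lt with rfl | htT
      · have h1 : Tendsto x (𝓝[Ico a T] T) (𝓝 (z T)) :=
          hlim.mono_left (nhdsWithin_mono _ fun s hs => ⟨hI hs, hs.2.ne⟩)
        rw [ContinuousWithinAt, if_neg (lt_irrefl T)]
        exact h1.congr' ((hyx.mono fun s hs => hs.2).symm.eventuallyEq_of_mem self_mem_nhdsWithin)
      · refine continuousWithinAt_of_notMem_closure fun h => ?_
        exact absurd (closure_minimal Ico_subset_Icc_self isClosed_Icc h).2 (not_le.2 htT)
  · obtain ⟨E, hE, hEac⟩ := hx.acgStar.2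
    refine ⟨fun k => Nat.casesOn k (Icc T c) fun j => E j ∩ Ico a T, ?_, ?_⟩
    · rw [hsplit]
      ext t
      simp only [mem_union, mem_iUnion]
      constructor
      · rintro (h | h)
        · obtain ⟨j, hj⟩ := mem_iUnion.1 (hE ▸ hI h)
          exact ⟨j + 1, hj, h⟩
        · exact ⟨0, h⟩
      · rintro ⟨_ | j, h⟩
        · exact Or.inr h
        · exact Or.inl h.2
    · rintro (_ | j)
      · exact (acStarOn_of_lipschitzWith hz _).congr ordConnected_Ici (fun s hs => hs.1) hyz
      · exact ((hEac j).mono inter_subset_left).congr ordConnected_Iio (fun s hs => hs.2.2) hyx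
  · have hne : ∀ᵐ t : ℝ, t ≠ T ∧ t ≠ c := by
      filter_upwards [MeasureTheory.Measure.ae_ne MeasureTheory.volume T,
        MeasureTheory.Measure.ae_ne MeasureTheory.volume c] with t h1 h2 using ⟨h1, h2⟩
    filter_upwards [hx.inclusion, hzF, hne] with t h1 h2 h3 ht
    rcases lt_or_gt_of_ne h3.1 with htT | htT
    · obtain ⟨v, hv, hd⟩ := h1 (hI ⟨ht.1, htT⟩)
      refine ⟨v, by simpa [htT] using hv, ?_⟩
      refine (hd.mono_of_mem_nhdsWithin (hnhds t htT)).congr_of_eventuallyEq ?_ (hyx htT)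
      exact hyx.eventuallyEq_of_mem (mem_nhdsWithin_of_mem_nhds (Iio_mem_nhds htT))
    · obtain ⟨v, hv, hd⟩ := h2 ⟨htT, lt_of_le_of_ne ht.2 h3.2⟩
      refine ⟨v, by simpa [htT.not_gt] using hv, ?_⟩
      exact (hd.congr_of_eventuallyEq (hyz.eventuallyEq_of_mem (Ici_mem_nhds htT))).hasDerivWithinAt

end GenFilippov

open GenFilippov in
theorem mainTheorem2 {n : ℕ} (T ε : ℝ) (hT : 0 < T) (hε : 0 < ε)
    (F : GenFilippov.State n × ℝ → Set (GenFilippov.State n))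
    (husc : ∀ K : Set (GenFilippov.State n × ℝ),
      K ⊆ Set.univ ×ˢ Set.Ico T (T + ε) → IsCompact K → UpperHemicontinuousOn F K)
    (hval : ∀ p ∈ (Set.univ : Set (GenFilippov.State n)) ×ˢ Set.Ico T (T + ε),
      (F p).Nonempty ∧ IsCompact (F p) ∧ Convex ℝ (F p))
    (x : ℝ → GenFilippov.State n) (I : Set ℝ)
    (hx : GenFilippov.IsMaximalGeneralizedSolution F x I)
    (hsup : (T : EReal) ≤ GenFilippov.supTime I)
    (hlim : ∃ l : GenFilippov.State n,
      Filter.Tendsto x (nhdsWithin T (I \ {T})) (nhds l)) :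
    ∃ δ : ℝ, 0 < δ ∧ ((T + δ : ℝ) : EReal) ≤ GenFilippov.supTime I := by
  by_contra! hcon
  obtain ⟨l, hl⟩ := hlim
  obtain ⟨hsol, hmax⟩ := hx
  have hle : ∀ t ∈ I, (t : EReal) ≤ supTime I := fun t ht => le_sSup (mem_image_of_mem _ ht)
  have hIT : I ⊆ Iic T := fun t ht => by
    by_contra! h
    have := hcon (t - T) (sub_pos.2 (not_le.1 h))
    rw [add_sub_cancel] at this
    exact absurd (hle t ht) (not_le.2 this)
  have hlt : ∀ s < T, ∃ t ∈ I, s < t := fun s hs => by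
    obtain ⟨_, ⟨t, ht, rfl⟩, hst⟩ := lt_sSup_iff.1 ((EReal.coe_lt_coe_iff.2 hs).trans_le hsup)
    exact ⟨t, ht, EReal.coe_lt_coe_iff.1 hst⟩
  -- Otherwise `I ⊆ {T}` would be null.
  obtain ⟨a, haI, haT⟩ : ∃ a ∈ I, a < T := by
    by_contra! h
    refine hsol.interval.2 (MeasureTheory.measure_mono_null (t := {T}) (fun t ht => ?_) (by simp))
    exact le_antisymm (hIT ht) (h t ht)
  have hIco : Ico a T ⊆ I := fun s hs => by
    obtain ⟨t, ht, hst⟩ := hlt s hs.2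
    exact hsol.interval.1.isPreconnected.Icc_subset haI ht ⟨hs.1, hst.le⟩
  have hsub : Metric.closedBall l 1 ×ˢ Icc T (T + ε / 2) ⊆
      (univ : Set (State n)) ×ˢ Ico T (T + ε) :=
    prod_mono (subset_univ _) fun t ht => ⟨ht.1, by linarith [ht.2]⟩
  obtain ⟨δ, hδ, M, z, hz, rfl, hzF⟩ := exists_lipschitz_solution (l := l)
    (show T < T + ε / 2 by linarith) one_pos
    (husc _ hsub ((isCompact_closedBall l 1).prod isCompact_Icc)) fun p hp => hval p (hsub hp)
  refine hmax ⟨_, _, hsol.glue haT (lt_add_of_pos_right T hδ) hIco hz hl hzF,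
    ⟨a, ⟨le_rfl, by linarith⟩, haI⟩, ?_, ?_⟩
  · refine (hcon δ hδ).trans_le (le_sSup (mem_image_of_mem _ ?_))
    exact ⟨by linarith, le_rfl⟩
  · rintro t ⟨htI, ht⟩
    rcases lt_or_eq_of_le (mem_Iic.1 (hIT htI)) with htT | rfl
    · simp [htT]
    -- If `T ∈ I`, continuity of `x` on `I` forces its value there to be the limit.
    · have hcl : (𝓝[Ico a t] t).NeBot := by
        rw [nhdsWithin_Ico_eq_nhdsLT haT]
        infer_instance
      have h1 : Tendsto x (𝓝[Ico a t] t) (𝓝 (x t)) := (hsol.acgStar.1 t htI).mono hIco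
      have h2 : Tendsto x (𝓝[Ico a t] t) (𝓝 (z t)) :=
        hl.mono_left (nhdsWithin_mono _ fun s hs => ⟨hIco hs, hs.2.ne⟩)
      simpa using tendsto_nhds_unique h1 h2
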